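/- Let $X$ be a second-countable compact Hausdorff space without isolated points, let $G$ be a countable discrete group, and let $P\subseteq G$ be a subsemigroup containing the identity $e$ such that $G=P^{-1}P=PP^{-1}$. Let $\theta$ be a right action of $P$ on $X$ by homeomorphisms, i.e. each $\theta_m$ ($m\in P$) is a homeomorphism of $X$, $\theta_e=\mathrm{id}_X$ and $\theta_n\theta_m=\theta_{mn}$ for $m,n\in P$. For $g=mn^{-1}\in G$ with $m,n\in P$ put $\tilde\theta_g=\theta_n^{-1}\theta_m$; this is well defined and gives a right action $\tilde\theta$ of $G$ on $X$ by homeomorphisms. Let $$\mathcal G(X,P,\theta)=\{(x,g,y)\in X\times G\times X:\ \exists\, m,n\in P,\ g=mn^{-1},\ \theta_m(x)=\theta_n(y)\}$$ be the groupoid with $(x,g,y)(y,h,v)=(x,gh,v)$ and $(x,g,y)^{-1}=(y,g^{-1},x)$, and with the topology generated by the sets $\Sigma(U,m,n,V)=\{(x,mn^{-1},y):\theta_m(x)=\theta_n(y),\,x\in U,\,y\in V\}$, where $m,n\in P$ and $U,V\subseteq X$ are open sets such that $\theta_m|_U$, $\theta_n|_V$ are homeomorphisms onto their images and $\theta_m(U)=\theta_n(V)$.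 Let $X\rtimes_{\tilde\theta}G$ be the set $X\times G$ with the product topology, with multiplication $(x,g)(y,h)=(x,gh)$ if $y=\tilde\theta_g(x)$, and inverse $(x,g)^{-1}=(\tilde\theta_g(x),g^{-1})$. Then both are étale groupoids, and the map $$\Lambda:\mathcal G(X,P,\theta)\to X\rtimes_{\tilde\theta}G,\qquad \Lambda(x,g,y)=(x,g),$$ is an isomorphism of étale groupoids (a homeomorphism that is an isomorphism of groupoids). Moreover, let $C(X)\rtimes_{\tilde\theta,r}G$ be the reduced crossed product for the action $g\cdot f=f\circ\tilde\theta_g$ of $G$ on $C(X)$, with canonical unitaries $u_g$. Then $\Lambda$ induces a $*$-isomorphism $\Phi$ from the reduced groupoid $C^*$-algebra $C^*_r(\mathcal G(X,P,\theta))$ onto $C(X)\rtimes_{\tilde\theta,r}G$: each $f\in C_c(\mathcal G(X,P,\theta))$ is of the form $f(\gamma)=a_g(x)$ with $(x,g)=\Lambda(\gamma)$ for a finitely supported family $(a_g)_{g\in G}$ in $C(X)$, and $\Phi(f)=\sum_g a_gu_g$. It satisfies $\Phi(C(X))=C(X)$, where the first $C(X)$ is the algebra of continuous functions on the unit space $\{(x,e,x):x\in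 X\}\cong X$ of $\mathcal G(X,P,\theta)$, and the second is the canonical copy of $C(X)$ in the crossed product. -/

import Mathlib

open Topology
open scoped CompactlySupported

/-! ### Topological and étale groupoids -/

/-- A groupoid in the one-sorted sense: a set `Γ` of arrows with a set of composable pairs, a partial
multiplication, and an inverse. -/
class ArrowGroupoid (Γ : Type*) where
  composable : Set (Γ × Γ)
  mul : composable → Γ
  inv : Γ → Γ
  inv_inv : ∀ a, inv (inv a) = a
  composable_inv : ∀ a, (a, inv a) ∈ composable
  assoc : ∀ (a b c : Γ) (hab : (a, b) ∈ composable) (hbc : (b, c) ∈ composable),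
    ∃ (h₁ : (mul ⟨(a, b), hab⟩, c) ∈ composable) (h₂ : (a, mul ⟨(b, c), hbc⟩) ∈ composable),
      mul ⟨_, h₁⟩ = mul ⟨_, h₂⟩
  inv_mul_cancel_left : ∀ (a b : Γ) (hab : (a, b) ∈ composable),
    ∃ h : (inv a, mul ⟨(a, b), hab⟩) ∈ composable, mul ⟨_, h⟩ = b
  mul_inv_cancel_right : ∀ (a b : Γ) (hab : (a, b) ∈ composable),
    ∃ h : (mul ⟨(a, b), hab⟩, inv b) ∈ composable, mul ⟨_, h⟩ = a

namespace ArrowGroupoid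

section
variable {Γ : Type*} [ArrowGroupoid Γ]

theorem inv_composable (a : Γ) : (inv a, a) ∈ composable (Γ := Γ) := by
  have h := composable_inv (inv a)
  rwa [inv_inv] at h

/-- `r(a) = a a⁻¹`. -/
def range (a : Γ) : Γ := mul ⟨(a, inv a), composable_inv a⟩

/-- `d(a) = a⁻¹ a`. -/
def source (a : Γ) : Γ := mul ⟨(inv a, a), inv_composable a⟩

variable (Γ) in
/-- The unit space `Γ⁽⁰⁾`. -/
def unitSpace : Set Γ := Set.range (range : Γ → Γ)

theorem range_mem_unitSpace (a : Γ) : range a ∈ unitSpace Γ := ⟨a, rfl⟩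

theorem source_mem_unitSpace (a : Γ) : source a ∈ unitSpace Γ := by
  refine ⟨inv a, ?_⟩
  simp only [range, source, inv_inv]

end

/-- `Γ` is an étale topological groupoid: inversion and multiplication are continuous, and the range
and the domain maps onto the unit space are local homeomorphisms. -/
structure IsEtale (Γ : Type*) [TopologicalSpace Γ] [ArrowGroupoid Γ] : Prop where
  continuous_inv : Continuous (inv : Γ → Γ)
  continuous_mul : Continuous (mul : composable (Γ := Γ) → Γ)
  range_local : IsLocalHomeomorph (fun a : Γ => (⟨range a, range_mem_unitSpace a⟩ : unitSpace Γ))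
  source_local : IsLocalHomeomorph (fun a : Γ => (⟨source a, source_mem_unitSpace a⟩ : unitSpace Γ))

/-- An isomorphism of topological groupoids: a homeomorphism that preserves and reflects
composability, and respects multiplication and inversion. -/
structure IsTopIso {Γ Δ : Type*} [TopologicalSpace Γ] [ArrowGroupoid Γ]
    [TopologicalSpace Δ] [ArrowGroupoid Δ] (φ : Γ → Δ) : Prop where
  homeo : IsHomeomorph φ
  map_composable : ∀ a b : Γ, (a, b) ∈ composable (Γ := Γ) ↔ (φ a, φ b) ∈ composable (Γ := Δ)
  map_mul : ∀ (a b : Γ) (h : (a, b) ∈ composable (Γ := Γ)),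
    φ (mul ⟨(a, b), h⟩) = mul ⟨(φ a, φ b), (map_composable a b).1 h⟩
  map_inv : ∀ a : Γ, φ (inv a) = inv (φ a)

/-! ### The reduced C*-algebra of an étale groupoid -/

/-- The Hilbert space `ℓ²(Γ) = ⨁ₓ ℓ²(Γₓ)`, the sum over the units `x` of the spaces
`ℓ²(Γₓ)`, where `Γₓ = d⁻¹(x)`. -/
abbrev L2 (Γ : Type*) : Type _ := lp (fun _ : Γ => ℂ) 2

open Classical in
/-- `T` is the bounded operator by which `f ∈ C_c(Γ)` acts in the left regular representation, i.e.
in the direct sum over the units `x` of the representations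
`(λₓ(f) ξ)(γ) = ∑_{αβ = γ} f(α) ξ(β)` on `ℓ²(Γₓ)`. It is described by its matrix: the `γ`-th
coordinate of `T δ_β` is `f(γβ⁻¹)` if `γβ⁻¹` is defined, and `0` otherwise. There is at most one such
`T`; when `Γ` is étale (locally compact and Hausdorff) there is exactly one. -/
def IsRegularRep {Γ : Type*} [TopologicalSpace Γ] [ArrowGroupoid Γ] (f : C_c(Γ, ℂ))
    (T : L2 Γ →L[ℂ] L2 Γ) : Prop :=
  ∀ β γ : Γ, T (lp.single 2 β (1 : ℂ)) γ =
    if h : (γ, inv β) ∈ composable (Γ := Γ) then f (mul ⟨(γ, inv β), h⟩) else 0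

/-- The reduced groupoid C*-algebra `C*_r(Γ)`: the C*-algebra generated by the image of `C_c(Γ)` under
the left regular representation. (The image is already a *-algebra when `Γ` is étale, so this is its
norm closure, the completion of `C_c(Γ)` in the norm `sup_x ‖λₓ(f)‖`.) -/
noncomputable def reducedCstar (Γ : Type*) [TopologicalSpace Γ] [ArrowGroupoid Γ] :
    NonUnitalStarSubalgebra ℂ (L2 Γ →L[ℂ] L2 Γ) :=
  (NonUnitalStarAlgebra.adjoin ℂ
    {T : L2 Γ →L[ℂ] L2 Γ | ∃ f : C_c(Γ, ℂ), IsRegularRep f T}).topologicalClosure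

/-- The canonical copy of `C₀(Γ⁽⁰⁾)` in `C*_r(Γ)`: the closure of the set of the `f ∈ C_c(Γ)` that
vanish off the (clopen) unit space. -/
def diagonal (Γ : Type*) [TopologicalSpace Γ] [ArrowGroupoid Γ] : Set (L2 Γ →L[ℂ] L2 Γ) :=
  closure {T | ∃ f : C_c(Γ, ℂ), (∀ γ ∉ unitSpace Γ, f γ = 0) ∧ IsRegularRep f T}

end ArrowGroupoid

/-! ### Semigroup actions -/

/-- The standing assumption on the subsemigroup `P ∋ e` of `G`: `G = P⁻¹P = PP⁻¹`. -/
class IsTwoSidedOre {G : Type*} [Group G] (P : Submonoid G) : Prop where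
  left : ∀ g : G, ∃ m n : P, g = (m : G)⁻¹ * (n : G)
  right : ∀ g : G, ∃ m n : P, g = (m : G) * (n : G)⁻¹

/-- A right action of `P` on `X` by surjective local homeomorphisms. -/
structure RightSemigroupAction (X : Type*) [TopologicalSpace X] {G : Type*} [Group G]
    (P : Submonoid G) where
  act : P → X → X
  isLocalHomeomorph : ∀ n, IsLocalHomeomorph (act n)
  surjective : ∀ n, Function.Surjective (act n)
  act_one : ∀ x, act 1 x = x
  act_act : ∀ n m x, act n (act m x) = act (m * n) x

/-- A right action of the discrete group `G` on `X` by homeomorphisms (the inverse of `act g` is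
`act g⁻¹`). -/
structure GroupRightAction (X : Type*) [TopologicalSpace X] (G : Type*) [Group G] where
  act : G → X → X
  continuous_act : ∀ g, Continuous (act g)
  act_one : ∀ x, act 1 x = x
  act_act : ∀ g h x, act g (act h x) = act (h * g) x

namespace RightSemigroupAction

variable {X : Type*} [TopologicalSpace X] {G : Type*} [Group G] {P : Submonoid G}

/-- The underlying set of `𝒢(X,P,θ)`: the triples `(x,g,y)` such that `g = mn⁻¹` and
`θ_m(x) = θ_n(y)` for some `m, n ∈ P`. -/
def Arrows (θ : RightSemigroupAction X P) : Type _ :=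
  {p : X × G × X // ∃ m n : P, p.2.1 = (m : G) * (n : G)⁻¹ ∧ θ.act m p.1 = θ.act n p.2.2}

/-- The set `Σ(U,m,n,V)`. -/
def basicOpen (θ : RightSemigroupAction X P) (U : Set X) (m n : P) (V : Set X) : Set θ.Arrows :=
  {γ | γ.1.2.1 = (m : G) * (n : G)⁻¹ ∧ θ.act m γ.1.1 = θ.act n γ.1.2.2 ∧ γ.1.1 ∈ U ∧ γ.1.2.2 ∈ V}

/-- The topology of `𝒢(X,P,θ)`, generated by the sets `Σ(U,m,n,V)` with `U`, `V` open, `θ_m|_U` and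
`θ_n|_V` homeomorphisms onto their images, and `θ_m(U) = θ_n(V)`. -/
instance (θ : RightSemigroupAction X P) : TopologicalSpace θ.Arrows :=
  TopologicalSpace.generateFrom
    {S | ∃ (U V : Set X) (m n : P), IsOpen U ∧ IsOpen V ∧
      IsEmbedding (U.domRestrict (θ.act m)) ∧ IsEmbedding (V.domRestrict (θ.act n)) ∧
      θ.act m '' U = θ.act n '' V ∧ S = θ.basicOpen U m n V}

theorem mul_mem [IsTwoSidedOre P] (θ : RightSemigroupAction X P) {x y z : X} {g h : G}
    (h₁ : ∃ m n : P, g = (m : G) * (n : G)⁻¹ ∧ θ.act m x = θ.act n y)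
    (h₂ : ∃ m n : P, h = (m : G) * (n : G)⁻¹ ∧ θ.act m y = θ.act n z) :
    ∃ m n : P, g * h = (m : G) * (n : G)⁻¹ ∧ θ.act m x = θ.act n z := by
  obtain ⟨m, n, rfl, e₁⟩ := h₁
  obtain ⟨k, l, rfl, e₂⟩ := h₂
  obtain ⟨p, q, e⟩ := IsTwoSidedOre.right (P := P) ((n : G)⁻¹ * (k : G))
  have e' : n * p = k * q := by
    apply Subtype.ext
    push_cast
    have : (k : G) = n * (p * (q : G)⁻¹) := by rw [← e]; group
    rw [this]; group
  refine ⟨m * p, l * q, ?_, ?_⟩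
  · push_cast
    calc (m : G) * (n : G)⁻¹ * (k * (l : G)⁻¹) = m * ((n : G)⁻¹ * k) * (l : G)⁻¹ := by group
      _ = _ := by rw [e]; group
  · rw [← θ.act_act, ← θ.act_act, e₁, θ.act_act, e', ← θ.act_act, e₂]

/-- The groupoid structure of `𝒢(X,P,θ)`: `(x,g,y)(y,h,v) = (x,gh,v)` and
`(x,g,y)⁻¹ = (y,g⁻¹,x)`. -/
instance [IsTwoSidedOre P] (θ : RightSemigroupAction X P) : ArrowGroupoid θ.Arrows where
  composable := {p | p.1.1.2.2 = p.2.1.1}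
  mul p := ⟨(p.1.1.1.1, p.1.1.1.2.1 * p.1.2.1.2.1, p.1.2.1.2.2),
    θ.mul_mem p.1.1.2 (by
      have h : p.1.1.1.2.2 = p.1.2.1.1 := p.2
      rw [h]; exact p.1.2.2)⟩
  inv a := ⟨(a.1.2.2, a.1.2.1⁻¹, a.1.1), by
    obtain ⟨m, n, e, h⟩ := a.2
    exact ⟨n, m, by simp [e], h.symm⟩⟩
  inv_inv a := by apply Subtype.ext; simp
  composable_inv a := rfl
  assoc a b c hab hbc := ⟨hbc, hab, by apply Subtype.ext; simp [mul_assoc]⟩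
  inv_mul_cancel_left a b hab := ⟨rfl, by
    have h : a.1.2.2 = b.1.1 := hab
    apply Subtype.ext; simp [h]⟩
  mul_inv_cancel_right a b hab := ⟨rfl, by
    have h : a.1.2.2 = b.1.1 := hab
    apply Subtype.ext; simp [← h]⟩

/-- `(X,P,θ)` is a semigroup action by homeomorphisms. -/
def ByHomeomorphisms (θ : RightSemigroupAction X P) : Prop := ∀ m, IsHomeomorph (θ.act m)

variable {θ : RightSemigroupAction X P}

/-- `θ_m` as a homeomorphism. -/
noncomputable def ByHomeomorphisms.homeo (hθ : θ.ByHomeomorphisms) (m : P) : X ≃ₜ X :=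
  (hθ m).homeomorph

theorem ByHomeomorphisms.homeo_apply (hθ : θ.ByHomeomorphisms) (m : P) (x : X) :
    hθ.homeo m x = θ.act m x := rfl

/-- `θ̃_g = θ_n⁻¹ ∘ θ_m`, where `g = mn⁻¹`; it does not depend on the choice of `m` and `n`, see
`ByHomeomorphisms.tilde_eq`. -/
noncomputable def ByHomeomorphisms.tilde [IsTwoSidedOre P] (hθ : θ.ByHomeomorphisms) (g : G) (x : X) :
    X :=
  (hθ.homeo (IsTwoSidedOre.right (P := P) g).choose_spec.choose).symm
    (hθ.homeo (IsTwoSidedOre.right (P := P) g).choose x)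

theorem ByHomeomorphisms.act_tilde [IsTwoSidedOre P] (hθ : θ.ByHomeomorphisms) {g : G} {m n : P}
    (e : g = (m : G) * (n : G)⁻¹) (x : X) : θ.act n (hθ.tilde g x) = θ.act m x := by
  set a := (IsTwoSidedOre.right (P := P) g).choose with ha
  set b := (IsTwoSidedOre.right (P := P) g).choose_spec.choose with hb
  have e₁ : g = (a : G) * (b : G)⁻¹ := (IsTwoSidedOre.right (P := P) g).choose_spec.choose_spec
  have e₂ : θ.act b (hθ.tilde g x) = θ.act a x := by
    rw [← hθ.homeo_apply]
    exact (hθ.homeo b).apply_symm_apply _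
  obtain ⟨p, q, h⟩ := IsTwoSidedOre.right (P := P) ((m : G)⁻¹ * (a : G))
  have h₁ : m * p = a * q := by
    apply Subtype.ext
    push_cast
    have : (a : G) = m * (p * (q : G)⁻¹) := by rw [← h]; group
    rw [this]; group
  have h₂ : n * p = b * q := by
    apply Subtype.ext
    push_cast
    have hn : (n : G) = g⁻¹ * m := by rw [e]; group
    have hb' : (b : G) = g⁻¹ * a := by rw [e₁]; group
    have h₁' : (m : G) * p = a * q := by exact_mod_cast congrArg Subtype.val h₁
    rw [hn, hb', mul_assoc, mul_assoc, h₁']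
  apply (hθ p).injective
  rw [θ.act_act, θ.act_act, h₁, h₂, ← θ.act_act, ← θ.act_act, e₂]

theorem ByHomeomorphisms.tilde_eq [IsTwoSidedOre P] (hθ : θ.ByHomeomorphisms) (m n : P) (x : X) :
    hθ.tilde ((m : G) * (n : G)⁻¹) x = (hθ.homeo n).symm (hθ.homeo m x) := by
  rw [(hθ.homeo n).eq_symm_apply]
  exact hθ.act_tilde rfl x

/-- The right action `(X,G,θ̃)` of `G` that extends the action of `P`. -/
noncomputable def ByHomeomorphisms.extend [IsTwoSidedOre P] (hθ : θ.ByHomeomorphisms) :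
    GroupRightAction X G where
  act := hθ.tilde
  continuous_act g := (hθ.homeo _).symm.continuous.comp (hθ.homeo _).continuous
  act_one x := by
    have h := hθ.act_tilde (g := 1) (m := 1) (n := 1) (by simp) x
    rwa [θ.act_one, θ.act_one] at h
  act_act g h x := by
    obtain ⟨m, n, e₁⟩ := IsTwoSidedOre.right (P := P) h
    obtain ⟨k, l, e₂⟩ := IsTwoSidedOre.right (P := P) g
    obtain ⟨u, v, e, h₃⟩ := θ.mul_mem ⟨m, n, e₁, (hθ.act_tilde e₁ x).symm⟩
      ⟨k, l, e₂, (hθ.act_tilde e₂ (hθ.tilde h x)).symm⟩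
    apply (hθ v).injective
    rw [hθ.act_tilde e, h₃]

end RightSemigroupAction

/-! ### The transformation groupoid and the C*-dynamical system of a group action -/

namespace GroupRightAction

variable {X : Type*} [TopologicalSpace X] {G : Type*} [Group G]

theorem act_inv_act (α : GroupRightAction X G) (g : G) (x : X) : α.act g⁻¹ (α.act g x) = x := by
  rw [α.act_act, mul_inv_cancel, α.act_one]

theorem act_act_inv (α : GroupRightAction X G) (g : G) (x : X) : α.act g (α.act g⁻¹ x) = x := by
  rw [α.act_act, inv_mul_cancel, α.act_one]

/-- The underlying set `X × G` of the transformation groupoid `X ⋊_α G`. -/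
def Transf (_α : GroupRightAction X G) : Type _ := X × G

/-- The product topology (`G` is to carry the discrete topology). -/
instance [TopologicalSpace G] (α : GroupRightAction X G) : TopologicalSpace α.Transf :=
  inferInstanceAs (TopologicalSpace (X × G))

/-- `(x,g)(y,h) = (x,gh)` if `y = α_g(x)`, and `(x,g)⁻¹ = (α_g(x),g⁻¹)`. -/
instance (α : GroupRightAction X G) : ArrowGroupoid α.Transf where
  composable := {p | p.2.1 = α.act p.1.2 p.1.1}
  mul p := (p.1.1.1, p.1.1.2 * p.1.2.2)
  inv a := (α.act a.2 a.1, a.2⁻¹)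
  inv_inv a := Prod.ext (α.act_inv_act a.2 a.1) (_root_.inv_inv a.2)
  composable_inv a := rfl
  assoc a b c hab hbc := ⟨by
      have h₁ : b.1 = α.act a.2 a.1 := hab
      have h₂ : c.1 = α.act b.2 b.1 := hbc
      change c.1 = α.act (a.2 * b.2) a.1
      rw [h₂, h₁, α.act_act], hab, Prod.ext rfl (mul_assoc _ _ _)⟩
  inv_mul_cancel_left a b hab := by
    have h₁ : b.1 = α.act a.2 a.1 := hab
    exact ⟨(α.act_inv_act a.2 a.1).symm, Prod.ext h₁.symm (inv_mul_cancel_left a.2 b.2)⟩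
  mul_inv_cancel_right a b hab := by
    have h₁ : b.1 = α.act a.2 a.1 := hab
    refine ⟨?_, Prod.ext rfl (mul_inv_cancel_right a.2 b.2)⟩
    change α.act b.2 b.1 = α.act (a.2 * b.2) a.1
    rw [h₁, α.act_act]

/-- `α_g` as a homeomorphism. -/
def homeo (α : GroupRightAction X G) (g : G) : X ≃ₜ X where
  toFun := α.act g
  invFun := α.act g⁻¹
  left_inv := α.act_inv_act g
  right_inv := α.act_act_inv g
  continuous_toFun := α.continuous_act g
  continuous_invFun := α.continuous_act g⁻¹

/-- The action of `G` on `C(X)` by the automorphisms `f ↦ f ∘ α_g`. -/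
noncomputable def onFunctions (α : GroupRightAction X G) : G →* (C(X, ℂ) ≃⋆ₐ[ℂ] C(X, ℂ)) where
  toFun g := (α.homeo g).compStarAlgEquiv' ℂ ℂ
  map_one' := by
    ext f x
    exact congrArg f (α.act_one x)
  map_mul' g h := by
    ext f x
    exact congrArg f (α.act_act h g x).symm

end GroupRightAction

/-! ### Reduced crossed products -/

section CrossedProduct

variable {I H : Type*} [NormedAddCommGroup H] [InnerProductSpace ℂ H]

/-- The diagonal operator `(ξ_i) ↦ (T_i ξ_i)` on `ℓ²(I,H)`, for a bounded family `T`. -/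
noncomputable def lpDiag (T : I → H →L[ℂ] H) (C : ℝ) (hT : ∀ i, ‖T i‖ ≤ C) :
    lp (fun _ : I => H) 2 →L[ℂ] lp (fun _ : I => H) 2 :=
  have hle : ∀ (ξ : lp (fun _ : I => H) 2) (i : I), ‖T i (ξ i)‖ ≤ ‖((C : ℂ) • ξ : lp _ 2) i‖ := by
    intro ξ i
    have hC : 0 ≤ C := (norm_nonneg _).trans (hT i)
    rw [lp.coeFn_smul, Pi.smul_apply, norm_smul, Complex.norm_real, Real.norm_of_nonneg hC]
    exact (T i).le_of_opNorm_le (hT i) _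
  LinearMap.mkContinuous
    { toFun := fun ξ => ⟨fun i => T i (ξ i), (lp.memℓp ((C : ℂ) • ξ)).mono' (hle ξ)⟩
      map_add' := fun ξ η => by ext i; exact map_add (T i) _ _
      map_smul' := fun c ξ => by ext i; exact map_smul (T i) c _ }
    |C| (fun ξ => by
      have h := lp.norm_mono (p := 2) (by norm_num)
        (x := (⟨fun i => T i (ξ i), (lp.memℓp ((C : ℂ) • ξ)).mono' (hle ξ)⟩ : lp (fun _ : I => H) 2))
        (y := (C : ℂ) • ξ) (hle ξ)
      refine h.trans (le_of_eq ?_)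
      rw [norm_smul, Complex.norm_real, Real.norm_eq_abs])

theorem lpDiag_apply (T : I → H →L[ℂ] H) (C : ℝ) (hT : ∀ i, ‖T i‖ ≤ C) (ξ : lp (fun _ : I => H) 2)
    (i : I) : lpDiag T C hT ξ i = T i (ξ i) := rfl

/-- The operator `ξ ↦ ξ ∘ e` on `ℓ²(I,H)`, for a permutation `e` of `I`. -/
noncomputable def lpReindex (e : I ≃ I) :
    lp (fun _ : I => H) 2 →L[ℂ] lp (fun _ : I => H) 2 :=
  have hmem : ∀ ξ : lp (fun _ : I => H) 2, Memℓp (fun i => ξ (e i)) 2 := fun ξ =>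
    memℓp_gen ((e.summable_iff (f := fun i => ‖ξ i‖ ^ (2 : ENNReal).toReal)).2
      ((lp.memℓp ξ).summable (by norm_num)))
  LinearMap.mkContinuous
    { toFun := fun ξ => ⟨fun i => ξ (e i), hmem ξ⟩
      map_add' := fun ξ η => rfl
      map_smul' := fun c ξ => rfl }
    1 (fun ξ => by
      rw [one_mul]
      refine lp.norm_le_of_tsum_le (by norm_num) (norm_nonneg _) (le_of_eq ?_)
      rw [lp.norm_rpow_eq_tsum (by norm_num)]
      exact e.tsum_eq (fun i => ‖ξ i‖ ^ (2 : ENNReal).toReal))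

theorem lpReindex_apply (e : I ≃ I) (ξ : lp (fun _ : I => H) 2) (i : I) :
    lpReindex e ξ i = ξ (e i) := rfl

variable [CompleteSpace H] {G : Type*} [Group G] {A : Type*} [CStarAlgebra A]

/-- `(π̃(a) ξ)(g) = π(α_g⁻¹(a)) ξ(g)` on `ℓ²(G,H)`. -/
noncomputable def crossedPi (α : G →* (A ≃⋆ₐ[ℂ] A)) (π : A →⋆ₐ[ℂ] (H →L[ℂ] H)) (a : A) :
    lp (fun _ : G => H) 2 →L[ℂ] lp (fun _ : G => H) 2 :=
  lpDiag (fun g => π (α g⁻¹ a)) ‖a‖ (fun g =>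
    (NonUnitalStarAlgHom.norm_apply_le π _).trans (NonUnitalStarAlgHom.norm_apply_le (α g⁻¹) a))

variable (H) in
/-- `(u_h ξ)(g) = ξ(h⁻¹g)` on `ℓ²(G,H)`. -/
noncomputable def crossedU (h : G) : lp (fun _ : G => H) 2 →L[ℂ] lp (fun _ : G => H) 2 :=
  lpReindex (Equiv.mulLeft h⁻¹)

/-- The reduced crossed product `A ⋊_{α,r} G`, realised through a faithful representation `π` of `A`
on `H`: the C*-algebra on `ℓ²(G,H)` generated by the operators `π̃(a) u_g`. -/
noncomputable def reducedCrossedProduct (α : G →* (A ≃⋆ₐ[ℂ] A)) (π : A →⋆ₐ[ℂ] (H →L[ℂ] H)) :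
    NonUnitalStarSubalgebra ℂ (lp (fun _ : G => H) 2 →L[ℂ] lp (fun _ : G => H) 2) :=
  (NonUnitalStarAlgebra.adjoin ℂ
    {T | ∃ (a : A) (g : G), T = crossedPi α π a * crossedU H g}).topologicalClosure

end CrossedProduct

section Multiplication

variable (X : Type*) [TopologicalSpace X] [CompactSpace X]

/-- The representation of `C(X)` on `ℓ²(X)` by multiplication operators; it is faithful, see
`mulRep_injective`. -/
noncomputable def mulRep : C(X, ℂ) →⋆ₐ[ℂ] (lp (fun _ : X => ℂ) 2 →L[ℂ] lp (fun _ : X => ℂ) 2) where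
  toFun f := lpDiag (fun x => f x • ContinuousLinearMap.id ℂ ℂ) ‖f‖ (fun x => by
    rw [norm_smul]; simpa using f.norm_coe_le_norm x)
  map_one' := by ext ξ x; simp [lpDiag_apply]
  map_mul' f g := by ext ξ x; simp [lpDiag_apply, mul_assoc]
  map_zero' := by ext ξ x; simp [lpDiag_apply]
  map_add' f g := by ext ξ x; simp [lpDiag_apply, add_mul]
  commutes' c := by ext ξ x; simp [lpDiag_apply, Algebra.algebraMap_eq_smul_one]
  map_star' f := by
    rw [ContinuousLinearMap.star_eq_adjoint, ContinuousLinearMap.eq_adjoint_iff]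
    intro ξ η
    simp only [lp.inner_eq_tsum, lpDiag_apply]
    congr 1
    ext x
    simp; ring

theorem mulRep_apply (f : C(X, ℂ)) (ξ : lp (fun _ : X => ℂ) 2) (x : X) :
    mulRep X f ξ x = f x * ξ x := rfl

theorem mulRep_injective : Function.Injective (mulRep X) := by
  classical
  intro f g h
  ext x
  have := congrArg (fun T => T (lp.single 2 x (1 : ℂ)) x) h
  simpa [mulRep_apply] using this

end Multiplication

namespace GroupRightAction

variable {X : Type*} [TopologicalSpace X] [CompactSpace X] {G : Type*} [Group G]

/-- `ℓ²(G,ℓ²(X))`. -/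
abbrev L2 (_α : GroupRightAction X G) : Type _ := lp (fun _ : G => lp (fun _ : X => ℂ) 2) 2

/-- The reduced crossed product `C(X) ⋊_{α,r} G`. -/
noncomputable def crossedProduct (α : GroupRightAction X G) :
    NonUnitalStarSubalgebra ℂ (α.L2 →L[ℂ] α.L2) :=
  reducedCrossedProduct α.onFunctions (mulRep X)

/-- The canonical embedding of `C(X)` in `C(X) ⋊_{α,r} G`. -/
noncomputable def embed (α : GroupRightAction X G) (b : C(X, ℂ)) : α.L2 →L[ℂ] α.L2 :=
  crossedPi α.onFunctions (mulRep X) b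

/-- The element `∑_g a_g u_g` of `C(X) ⋊_{α,r} G` given by a finitely supported `a : G → C(X)`. -/
noncomputable def finiteSum (α : GroupRightAction X G) (a : G →₀ C(X, ℂ)) : α.L2 →L[ℂ] α.L2 :=
  a.sum fun g b => α.embed b * crossedU (lp (fun _ : X => ℂ) 2) g

end GroupRightAction

/-- The map `Λ(x,g,y) = (x,g)` from `𝒢(X,P,θ)` to `X ⋊_θ̃ G`. -/
noncomputable def RightSemigroupAction.ByHomeomorphisms.toTransf {X : Type*} [TopologicalSpace X]
    {G : Type*} [Group G] {P : Submonoid G} [IsTwoSidedOre P] {θ : RightSemigroupAction X P}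
    (hθ : θ.ByHomeomorphisms) (γ : θ.Arrows) : hθ.extend.Transf :=
  (γ.1.1, γ.1.2.1)

/-! Injectivity of `θ_n` forces `y = θ̃_g(x)` in every arrow `(x,g,y)`, so the third coordinate is
redundant and `Λ` is bijective. If `θ_m(U) = θ_n(V)`, the conditions on `y` in `Σ(U,m,n,V)` follow
from `x ∈ U` and `g = mn⁻¹`, so this set is `Λ⁻¹(U × {mn⁻¹})` (`mem_basicOpen_iff`). Every such
slice occurs (`isOpen_slice`), hence `Λ` is a homeomorphism, and étaleness transfers from the
transformation groupoid (`IsTopIso.isEtale`).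

For the C*-algebras, the unitary `δ_(x,g,y) ↦ δ_g ⊗ δ_y` identifies `ℓ²(𝒢)` with `ℓ²(G,ℓ²(X))`.
Comparing matrix entries shows that it conjugates the regular representation of `f` to `∑ a_g u_g`,
where the `a_g` are the slices of `f` (`isRegularRep_spatialEquiv_symm`). Generators therefore
correspond, and so do the closed algebras, since `*`-isomorphisms of C*-algebras are isometric.
Functions living on the units correspond to families concentrated at `g = 1`, that is, to `C(X)`
(`image_diagonal`). -/

namespace ArrowGroupoid

/-! ### Transport of étaleness along isomorphisms -/

variable {Γ Δ : Type*} [TopologicalSpace Γ] [ArrowGroupoid Γ] [TopologicalSpace Δ] [ArrowGroupoid Δ]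

theorem source_eq_range_inv {Γ : Type*} [ArrowGroupoid Γ] (a : Γ) : source a = range (inv a) := by
  simp only [range, source, inv_inv]

/-- Continuity of the operations together with the range map being a local homeomorphism suffices
for a topological groupoid to be étale. -/
theorem IsEtale.of_range (hi : Continuous (inv : Γ → Γ))
    (hm : Continuous (mul : composable (Γ := Γ) → Γ))
    (hr : IsLocalHomeomorph
      (fun a : Γ => (⟨range a, range_mem_unitSpace a⟩ : unitSpace Γ))) : IsEtale Γ where
  continuous_inv := hi
  continuous_mul := hm
  range_local := hr
  source_local := by
    have h := hr.comp (Homeomorph.mk ⟨inv, inv, inv_inv, inv_inv⟩ hi hi).isLocalHomeomorph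
    convert! h using 1
    funext a
    exact Subtype.ext (source_eq_range_inv a)

/-- A factor cannot simply be rewritten inside `mul`, because the composability proof depends on it.
-/
theorem mul_congr {Γ : Type*} [ArrowGroupoid Γ] {a b b' : Γ} (h : b = b')
    (hb : (a, b) ∈ composable (Γ := Γ)) : mul ⟨(a, b), hb⟩ = mul ⟨(a, b'), h ▸ hb⟩ := by
  subst h; rfl

theorem IsTopIso.map_range {φ : Γ → Δ} (h : IsTopIso φ) (a : Γ) : φ (range a) = range (φ a) := by
  rw [range, h.map_mul, range, mul_congr (h.map_inv a)]

theorem IsTopIso.mem_unitSpace_iff {φ : Γ → Δ} (h : IsTopIso φ) (a : Γ) :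
    a ∈ unitSpace Γ ↔ φ a ∈ unitSpace Δ := by
  constructor
  · rintro ⟨b, rfl⟩
    exact ⟨φ b, (h.map_range b).symm⟩
  · rintro ⟨c, hc⟩
    obtain ⟨b, rfl⟩ := h.homeo.surjective c
    exact ⟨b, h.homeo.injective (by rw [h.map_range, hc])⟩

/-- Continuity can be tested after the inducing map `φ`, and the range map of `Γ` is that of `Δ`
conjugated by `φ` and its restriction to the unit spaces. -/
theorem IsTopIso.isEtale {φ : Γ → Δ} (h : IsTopIso φ) (hΔ : IsEtale Δ) : IsEtale Γ := by
  have hind := h.homeo.isEmbedding.isInducing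
  refine IsEtale.of_range ?_ ?_ ?_
  · rw [hind.continuous_iff]
    convert! hΔ.continuous_inv.comp h.homeo.continuous using 1
    funext a
    exact h.map_inv a
  · rw [hind.continuous_iff]
    have hc : Continuous (fun p : composable (Γ := Γ) =>
        (⟨(φ p.1.1, φ p.1.2), (h.map_composable _ _).1 p.2⟩ : composable (Γ := Δ))) :=
      Continuous.subtype_mk
        ((h.homeo.continuous.comp (continuous_fst.comp continuous_subtype_val)).prodMk
          (h.homeo.continuous.comp (continuous_snd.comp continuous_subtype_val))) _
    convert! hΔ.continuous_mul.comp hc using 1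
    funext p
    exact h.map_mul _ _ p.2
  · let e : unitSpace Γ ≃ₜ unitSpace Δ := h.homeo.homeomorph.subtype h.mem_unitSpace_iff
    have hl := e.symm.isLocalHomeomorph.comp
      (hΔ.range_local.comp h.homeo.homeomorph.isLocalHomeomorph)
    convert! hl using 1
    funext a
    rw [Function.comp_apply, e.eq_symm_apply]
    exact Subtype.ext (h.map_range a)

end ArrowGroupoid

/-! ### The transformation groupoid is étale -/

theorem isLocalHomeomorph_fst_of_discrete {X G : Type*} [TopologicalSpace X] [TopologicalSpace G]
    [DiscreteTopology G] : IsLocalHomeomorph (Prod.fst : X × G → X) := by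
  rw [isLocalHomeomorph_iff_isOpenEmbedding_restrict]
  intro p
  -- The slice through `p` is open because `G` is discrete, and the projection is injective on it.
  have hU : IsOpen (Set.univ ×ˢ {p.2} : Set (X × G)) := isOpen_univ.prod (isOpen_discrete _)
  refine ⟨_, hU.mem_nhds (by simp), .of_continuous_injective_isOpenMap
    (continuous_fst.comp continuous_subtype_val) ?_ (isOpenMap_fst.comp hU.isOpenMap_subtype_val)⟩
  intro ⟨⟨x, g⟩, _, hg⟩ ⟨⟨y, h⟩, _, hh⟩ hxy
  simp only [Set.mem_singleton_iff] at hg hh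
  have : x = y := hxy
  simp [this, hg, hh]

namespace GroupRightAction

variable {X : Type*} [TopologicalSpace X] {G : Type*} [Group G]

theorem Transf.mem_unitSpace_iff {α : GroupRightAction X G} (p : α.Transf) :
    p ∈ ArrowGroupoid.unitSpace α.Transf ↔ p.2 = 1 := by
  constructor
  · rintro ⟨b, rfl⟩
    exact mul_inv_cancel b.2
  · intro h
    exact ⟨p, Prod.ext rfl ((mul_inv_cancel p.2).trans h.symm)⟩

variable [TopologicalSpace G] [DiscreteTopology G]

/-- The unit space of `X ⋊_α G` is a copy of `X`. -/
def unitHomeo (α : GroupRightAction X G) : X ≃ₜ ArrowGroupoid.unitSpace α.Transf where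
  toFun x := ⟨((x, 1) : X × G), (Transf.mem_unitSpace_iff _).2 rfl⟩
  invFun p := p.1.1
  left_inv _ := rfl
  right_inv p := Subtype.ext (Prod.ext rfl ((Transf.mem_unitSpace_iff p.1).1 p.2).symm)
  continuous_toFun := Continuous.subtype_mk
    (show Continuous (fun x : X => ((x, 1) : X × G)) by fun_prop) _
  continuous_invFun :=
    (show Continuous (Prod.fst : X × G → X) from continuous_fst).comp continuous_subtype_val

theorem continuous_act_uncurry (α : GroupRightAction X G) :
    Continuous (fun p : X × G => α.act p.2 p.1) :=
  continuous_prod_of_discrete_right.2 α.continuous_act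

theorem isEtale_transf (α : GroupRightAction X G) : ArrowGroupoid.IsEtale α.Transf := by
  refine .of_range ?_ ?_ ?_
  · exact α.continuous_act_uncurry.prodMk (continuous_of_discreteTopology.comp continuous_snd)
  · have h : Continuous (fun p : (X × G) × (X × G) => (p.1.1, p.1.2 * p.2.2)) :=
      (continuous_fst.comp continuous_fst).prodMk
        ((continuous_of_discreteTopology (f := fun q : G × G => q.1 * q.2)).comp
          ((continuous_snd.comp continuous_fst).prodMk (continuous_snd.comp continuous_snd)))
    exact h.comp continuous_subtype_val
  · have h := α.unitHomeo.isLocalHomeomorph.comp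
      (isLocalHomeomorph_fst_of_discrete (X := X) (G := G))
    convert! h using 1
    funext p
    exact Subtype.ext (Prod.ext rfl (mul_inv_cancel p.2))

end GroupRightAction

/-! ### `Λ` is an isomorphism of topological groupoids -/

namespace RightSemigroupAction.ByHomeomorphisms

variable {X : Type*} [TopologicalSpace X] {G : Type*} [Group G] {P : Submonoid G}
  [IsTwoSidedOre P] {θ : RightSemigroupAction X P}

theorem tilde_apply (hθ : θ.ByHomeomorphisms) (γ : θ.Arrows) :
    hθ.tilde γ.1.2.1 γ.1.1 = γ.1.2.2 := by
  obtain ⟨m, n, e, h⟩ := γ.2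
  exact (hθ n).injective (by rw [hθ.act_tilde e, h])

/-- `Λ` as a bijection. -/
noncomputable def toTransfEquiv (hθ : θ.ByHomeomorphisms) : θ.Arrows ≃ hθ.extend.Transf where
  toFun := hθ.toTransf
  invFun p := ⟨(p.1, p.2, hθ.tilde p.2 p.1), by
    obtain ⟨m, n, e⟩ := IsTwoSidedOre.right (P := P) p.2
    exact ⟨m, n, e, (hθ.act_tilde e p.1).symm⟩⟩
  left_inv γ := Subtype.ext (Prod.ext rfl (Prod.ext rfl (hθ.tilde_apply γ)))
  right_inv _ := rfl

/-- The equation `θ_m(x) = θ_n(y)` is automatic for an arrow with `g = mn⁻¹`, and `θ_m(U) = θ_n(V)`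
with `θ_n` injective then puts `y` in `V`. -/
theorem mem_basicOpen_iff (hθ : θ.ByHomeomorphisms) {U V : Set X} {m n : P}
    (h : θ.act m '' U = θ.act n '' V) (γ : θ.Arrows) :
    γ ∈ θ.basicOpen U m n V ↔ γ.1.1 ∈ U ∧ γ.1.2.1 = (m : G) * (n : G)⁻¹ := by
  constructor
  · rintro ⟨e, -, hx, -⟩
    exact ⟨hx, e⟩
  · rintro ⟨hx, e⟩
    have h' : θ.act m γ.1.1 = θ.act n γ.1.2.2 := by rw [← hθ.tilde_apply γ, hθ.act_tilde e]
    obtain ⟨y, hy, hyx⟩ : θ.act m γ.1.1 ∈ θ.act n '' V := h ▸ Set.mem_image_of_mem _ hx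
    exact ⟨e, h', hx, (hθ n).injective (hyx.trans h') ▸ hy⟩

/-- Taking `V = θ_n⁻¹(θ_m(U))` turns the slice into a generator of the topology. -/
theorem isOpen_slice (hθ : θ.ByHomeomorphisms) {U : Set X} (hU : IsOpen U) (g : G) :
    IsOpen {γ : θ.Arrows | γ.1.1 ∈ U ∧ γ.1.2.1 = g} := by
  obtain ⟨m, n, rfl⟩ := IsTwoSidedOre.right (P := P) g
  have hV : θ.act m '' U = θ.act n '' (θ.act n ⁻¹' (θ.act m '' U)) :=
    (Set.image_preimage_eq _ (hθ n).surjective).symm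
  have hS : {γ : θ.Arrows | γ.1.1 ∈ U ∧ γ.1.2.1 = (m : G) * (n : G)⁻¹} =
      θ.basicOpen U m n (θ.act n ⁻¹' (θ.act m '' U)) :=
    Set.ext fun γ => (hθ.mem_basicOpen_iff hV γ).symm
  rw [hS]
  exact TopologicalSpace.isOpen_generateFrom_of_mem ⟨U, _, m, n, hU,
    ((hθ m).isOpenMap U hU).preimage (hθ n).continuous,
    (hθ m).isEmbedding.comp .subtypeVal, (hθ n).isEmbedding.comp .subtypeVal, hV, rfl⟩

theorem continuous_snd_arrows [TopologicalSpace G] [DiscreteTopology G]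
    (hθ : θ.ByHomeomorphisms) : Continuous (fun γ : θ.Arrows => γ.1.2.1) :=
  continuous_discrete_rng.2 fun g => by
    convert! hθ.isOpen_slice isOpen_univ g using 1
    ext γ
    simp

theorem continuous_fst_arrows (hθ : θ.ByHomeomorphisms) :
    Continuous (fun γ : θ.Arrows => γ.1.1) := by
  refine ⟨fun U hU => ?_⟩
  convert! isOpen_iUnion (hθ.isOpen_slice hU) using 1
  ext γ
  simp

/-- `Λ` as a homeomorphism. -/
noncomputable def toTransfHomeo [TopologicalSpace G] [DiscreteTopology G]
    (hθ : θ.ByHomeomorphisms) : θ.Arrows ≃ₜ hθ.extend.Transf where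
  toEquiv := hθ.toTransfEquiv
  continuous_toFun := hθ.continuous_fst_arrows.prodMk hθ.continuous_snd_arrows
  continuous_invFun := by
    refine continuous_generateFrom_iff.2 ?_
    rintro _ ⟨U, V, m, n, hU, -, -, -, h, rfl⟩
    have hS : hθ.toTransfEquiv.symm ⁻¹' θ.basicOpen U m n V = U ×ˢ {(m : G) * (n : G)⁻¹} :=
      Set.ext fun p => hθ.mem_basicOpen_iff h (hθ.toTransfEquiv.symm p)
    exact hS ▸ hU.prod (isOpen_discrete _)

theorem isTopIso_toTransf [TopologicalSpace G] [DiscreteTopology G] (hθ : θ.ByHomeomorphisms) :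
    ArrowGroupoid.IsTopIso hθ.toTransf where
  homeo := hθ.toTransfHomeo.isHomeomorph
  map_composable a b := by
    change a.1.2.2 = b.1.1 ↔ b.1.1 = hθ.tilde a.1.2.1 a.1.1
    rw [hθ.tilde_apply, eq_comm]
  map_mul _ _ _ := rfl
  map_inv a := Prod.ext (hθ.tilde_apply a).symm rfl

theorem mem_unitSpace_iff (hθ : θ.ByHomeomorphisms) (γ : θ.Arrows) :
    γ ∈ ArrowGroupoid.unitSpace θ.Arrows ↔ γ.1.2.1 = 1 := by
  -- The statement involves no topology on `G`; the discrete one is introduced only to apply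
  -- `isTopIso_toTransf`.
  let : TopologicalSpace G := ⊥
  have : DiscreteTopology G := ⟨rfl⟩
  rw [hθ.isTopIso_toTransf.mem_unitSpace_iff, GroupRightAction.Transf.mem_unitSpace_iff]
  rfl

end RightSemigroupAction.ByHomeomorphisms

/-! ### Bases and operators on `ℓ²` spaces -/

open Classical in
/-- The orthonormal basis of `ℓ²(G,ℓ²(X))` that consists of the vectors `δ_g ⊗ δ_x`, indexed through a
bijection onto `G × X`. -/
noncomputable def doubleBasis {ι G X : Type*} (e : ι ≃ G × X) :
    HilbertBasis ι ℂ (lp (fun _ : G => lp (fun _ : X => ℂ) 2) 2) :=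
  HilbertBasis.mkOfOrthogonalEqBot
    (v := fun i => lp.single 2 (e i).1 (lp.single 2 (e i).2 (1 : ℂ)))
    (by
      rw [orthonormal_iff_ite]
      intro i j
      rw [lp.inner_single_left, lp.single_apply, Pi.single_apply]
      by_cases h₁ : (e i).1 = (e j).1
      · rw [if_pos h₁, lp.inner_single_left, lp.single_apply, Pi.single_apply]
        by_cases h₂ : (e i).2 = (e j).2
        · rw [if_pos h₂, if_pos (e.injective (Prod.ext h₁ h₂))]
          simp
        · rw [if_neg h₂, if_neg fun h => h₂ (by rw [h]), inner_zero_right]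
      · rw [if_neg h₁, if_neg fun h => h₁ (by rw [h]), inner_zero_right])
    (by
      rw [Submodule.eq_bot_iff]
      intro ξ hξ
      rw [Submodule.mem_orthogonal] at hξ
      ext g x
      -- The inner product with this basis vector is the coordinate `ξ g x`.
      have h := hξ _ (Submodule.subset_span ⟨e.symm (g, x), rfl⟩)
      simpa [lp.inner_single_left] using h)

theorem doubleBasis_repr_apply {ι G X : Type*} (e : ι ≃ G × X)
    (ξ : lp (fun _ : G => lp (fun _ : X => ℂ) 2) 2) (i : ι) :
    (doubleBasis e).repr ξ i = ξ (e i).1 (e i).2 := by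
  classical
  rw [HilbertBasis.repr_apply_apply, doubleBasis, HilbertBasis.coe_mkOfOrthogonalEqBot]
  simp [lp.inner_single_left]

open Classical in
theorem doubleBasis_repr_symm_single_apply {ι G X : Type*} (e : ι ≃ G × X) (i : ι) (g : G) (x : X) :
    (doubleBasis e).repr.symm (lp.single 2 i (1 : ℂ)) g x =
      if g = (e i).1 ∧ x = (e i).2 then 1 else 0 := by
  have h := doubleBasis_repr_apply e ((doubleBasis e).repr.symm (lp.single 2 i (1 : ℂ)))
    (e.symm (g, x))
  rw [e.apply_symm_apply, LinearIsometryEquiv.apply_symm_apply] at h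
  rw [← h, lp.single_apply, Pi.single_apply]
  simp only [e.symm_apply_eq, Prod.ext_iff]

/-- A `*`-isomorphism restricts to one from a `*`-subalgebra onto its image. -/
def StarAlgEquiv.restrictNonUnital {A B : Type*} [NonUnitalRing A] [StarRing A] [Module ℂ A]
    [NonUnitalRing B] [StarRing B] [Module ℂ B]
    (e : A ≃⋆ₐ[ℂ] B) (S : NonUnitalStarSubalgebra ℂ A) (T : NonUnitalStarSubalgebra ℂ B)
    (h : ∀ a, a ∈ S ↔ e a ∈ T) : S ≃⋆ₐ[ℂ] T where
  toFun a := ⟨e a.1, (h a.1).1 a.2⟩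
  invFun b := ⟨e.symm b.1, (h _).2 (by rw [e.apply_symm_apply]; exact b.2)⟩
  left_inv a := Subtype.ext (e.symm_apply_apply a.1)
  right_inv b := Subtype.ext (e.apply_symm_apply b.1)
  map_mul' a b := Subtype.ext (map_mul e a.1 b.1)
  map_add' a b := Subtype.ext (map_add e a.1 b.1)
  map_smul' c a := Subtype.ext (map_smul e c a.1)
  map_star' a := Subtype.ext (map_star e a.1)

theorem StarAlgEquiv.restrictNonUnital_image {A B : Type*} [NonUnitalRing A] [StarRing A]
    [Module ℂ A] [NonUnitalRing B] [StarRing B] [Module ℂ B]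
    (e : A ≃⋆ₐ[ℂ] B) (S : NonUnitalStarSubalgebra ℂ A) (T : NonUnitalStarSubalgebra ℂ B)
    (h : ∀ a, a ∈ S ↔ e a ∈ T) {D : Set A} (hD : D ⊆ S) :
    (fun a => (e.restrictNonUnital S T h a).1) '' {a | a.1 ∈ D} = e '' D := by
  ext b
  constructor
  · rintro ⟨a, ha, rfl⟩
    exact ⟨a.1, ha, rfl⟩
  · rintro ⟨a, ha, rfl⟩
    exact ⟨⟨a, hD ha⟩, ha, rfl⟩

/-- A bounded operator on `ℓ²(Γ)` is determined by its values on the vectors `δ_β`. -/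
theorem ArrowGroupoid.IsRegularRep.unique {Γ : Type*} [TopologicalSpace Γ] [ArrowGroupoid Γ]
    {f : C_c(Γ, ℂ)} {S T : L2 Γ →L[ℂ] L2 Γ} (hS : IsRegularRep f S) (hT : IsRegularRep f T) :
    S = T := by
  classical
  refine lp.ext_continuousLinearMap (by norm_num) fun β => ?_
  ext γ
  refine Eq.trans ?_ ((hS β γ).trans ((hT β γ).symm.trans ?_)) <;>
  · simp only [ContinuousLinearMap.comp_apply, lp.singleContinuousLinearMap_apply]

/-- The image of `ξ` is dominated coordinatewise by `C • ξ`. The absolute value covers an empty `I`,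
where `C` may be negative. -/
theorem norm_lpDiag_le {I H : Type*} [NormedAddCommGroup H] [InnerProductSpace ℂ H]
    (T : I → H →L[ℂ] H) (C : ℝ) (hT : ∀ i, ‖T i‖ ≤ C) : ‖lpDiag T C hT‖ ≤ |C| := by
  refine ContinuousLinearMap.opNorm_le_bound _ (abs_nonneg C) fun ξ => ?_
  have h := lp.norm_mono (p := 2) (by norm_num) (x := lpDiag T C hT ξ) (y := (C : ℂ) • ξ)
    fun i => by
      rw [lp.coeFn_smul, Pi.smul_apply, norm_smul, Complex.norm_real, Real.norm_eq_abs,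
        lpDiag_apply]
      exact (T i).le_of_opNorm_le ((hT i).trans (le_abs_self C)) _
  rwa [norm_smul, Complex.norm_real, Real.norm_eq_abs] at h

/-! ### Finite sums and the copy of `C(X)` in the crossed product -/

namespace GroupRightAction

variable {X : Type*} [TopologicalSpace X] [CompactSpace X] {G : Type*} [Group G]

theorem embed_apply (α : GroupRightAction X G) (b : C(X, ℂ)) (ξ : α.L2) (g : G) (x : X) :
    α.embed b ξ g x = b (α.act g⁻¹ x) * ξ g x := rfl

theorem embed_mul_crossedU_apply (α : GroupRightAction X G) (b : C(X, ℂ)) (k : G) (ξ : α.L2) (g : G)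
    (x : X) : (α.embed b * crossedU (lp (fun _ : X => ℂ) 2) k : α.L2 →L[ℂ] α.L2) ξ g x =
      b (α.act g⁻¹ x) * ξ (k⁻¹ * g) x := rfl

theorem finiteSum_apply (α : GroupRightAction X G) (a : G →₀ C(X, ℂ)) (ξ : α.L2) (g : G) (x : X) :
    α.finiteSum a ξ g x = a.sum fun k b => b (α.act g⁻¹ x) * ξ (k⁻¹ * g) x := by
  simp only [finiteSum, Finsupp.sum, _root_.sum_apply, lp.coeFn_sum, Finset.sum_apply]
  rfl

theorem embed_zero (α : GroupRightAction X G) : α.embed 0 = 0 := by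
  ext ξ g x
  simp [embed_apply]

theorem embed_sub (α : GroupRightAction X G) (b c : C(X, ℂ)) :
    α.embed (b - c) = α.embed b - α.embed c := by
  ext ξ g x
  simp [embed_apply, sub_mul]

/-- The lower bound tests on `δ_1 ⊗ δ_x`, where the twist by `g⁻¹` is trivial. Isometry is needed
for `C(X)` to have closed image. -/
theorem norm_embed (α : GroupRightAction X G) (b : C(X, ℂ)) : ‖α.embed b‖ = ‖b‖ := by
  classical
  apply le_antisymm
  · have h : ‖α.embed b‖ ≤ |‖b‖| := by
      unfold embed crossedPi
      apply norm_lpDiag_le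
    rwa [abs_norm] at h
  · refine (ContinuousMap.norm_le b (norm_nonneg _)).2 fun x => ?_
    let ξ : α.L2 := lp.single 2 1 (lp.single 2 x 1)
    have hξ : ‖ξ‖ = 1 := by simp [ξ, lp.norm_single]
    have h : α.embed b ξ 1 x = b x := by simp [embed_apply, ξ, α.act_one]
    calc ‖b x‖ = ‖α.embed b ξ 1 x‖ := by rw [h]
      _ ≤ ‖α.embed b ξ 1‖ := lp.norm_apply_le_norm (by norm_num) _ _
      _ ≤ ‖α.embed b ξ‖ := lp.norm_apply_le_norm (by norm_num) _ _
      _ ≤ ‖α.embed b‖ := by simpa [hξ] using (α.embed b).le_opNorm ξ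

theorem isometry_embed (α : GroupRightAction X G) : Isometry α.embed :=
  Isometry.of_dist_eq fun b c => by rw [dist_eq_norm, dist_eq_norm, ← embed_sub, norm_embed]

theorem finiteSum_single (α : GroupRightAction X G) (g : G) (b : C(X, ℂ)) :
    α.finiteSum (Finsupp.single g b) = α.embed b * crossedU (lp (fun _ : X => ℂ) 2) g := by
  rw [finiteSum, Finsupp.sum_single_index]
  rw [embed_zero, zero_mul]

theorem finiteSum_single_one (α : GroupRightAction X G) (b : C(X, ℂ)) :
    α.finiteSum (Finsupp.single 1 b) = α.embed b := by
  rw [finiteSum_single]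
  ext ξ g x
  rw [embed_mul_crossedU_apply, embed_apply, inv_one, one_mul]

/-- Monomials `b u_g` and their finite sums generate the same algebra; the finite sums are what
`C_c(𝒢)` matches exactly. -/
theorem crossedProduct_eq (α : GroupRightAction X G) :
    α.crossedProduct =
      (NonUnitalStarAlgebra.adjoin ℂ (Set.range α.finiteSum)).topologicalClosure := by
  refine congrArg NonUnitalStarSubalgebra.topologicalClosure (le_antisymm ?_ ?_)
  · refine NonUnitalStarAlgebra.adjoin_mono ?_
    rintro _ ⟨b, g, rfl⟩
    exact ⟨_, α.finiteSum_single g b⟩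
  · refine NonUnitalStarAlgebra.adjoin_le ?_
    rintro _ ⟨a, rfl⟩
    exact sum_mem fun g _ => NonUnitalStarAlgebra.subset_adjoin ℂ _ ⟨a g, g, rfl⟩

end GroupRightAction

/-! ### The spatial isomorphism of the two C*-algebras -/

namespace RightSemigroupAction.ByHomeomorphisms

variable {X : Type*} [TopologicalSpace X] {G : Type*} [Group G] {P : Submonoid G}
  [IsTwoSidedOre P] {θ : RightSemigroupAction X P}

/-- An arrow `(x,g,y)` is determined by `(g,y)`. -/
noncomputable def sourceEquiv (hθ : θ.ByHomeomorphisms) : θ.Arrows ≃ G × X where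
  toFun γ := (γ.1.2.1, γ.1.2.2)
  -- The missing coordinate is `x = θ̃_{g⁻¹}(y)`.
  invFun p := hθ.toTransfEquiv.symm (hθ.tilde p.1⁻¹ p.2, p.1)
  left_inv γ := by
    refine hθ.toTransfEquiv.symm_apply_eq.2 (Prod.ext ?_ rfl)
    change hθ.extend.act _ _ = γ.1.1
    rw [← hθ.tilde_apply γ]
    exact hθ.extend.act_inv_act _ _
  right_inv p := Prod.ext rfl (hθ.extend.act_act_inv p.1 p.2)

theorem act_inv_target (hθ : θ.ByHomeomorphisms) (γ : θ.Arrows) :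
    hθ.extend.act γ.1.2.1⁻¹ γ.1.2.2 = γ.1.1 := by
  rw [← hθ.tilde_apply γ]
  exact hθ.extend.act_inv_act _ _

/-- The support of `f` has compact image in the discrete group `G`, so only finitely many slices are
nonzero. -/
theorem exists_coeff [TopologicalSpace G] [DiscreteTopology G] (hθ : θ.ByHomeomorphisms)
    (f : C_c(θ.Arrows, ℂ)) :
    ∃ a : G →₀ C(X, ℂ), ∀ γ : θ.Arrows, f γ = a γ.1.2.1 γ.1.1 := by
  have hfin : ((fun γ : θ.Arrows => γ.1.2.1) '' tsupport f).Finite :=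
    (f.hasCompactSupport.isCompact.image hθ.continuous_snd_arrows).finite_of_discrete
  let c : G → C(X, ℂ) := fun g => ⟨fun x => f (hθ.toTransfHomeo.symm (x, g)),
    f.continuous.comp (hθ.toTransfHomeo.symm.continuous.comp
      (show Continuous (fun x : X => ((x, g) : X × G)) by fun_prop))⟩
  refine ⟨Finsupp.onFinset hfin.toFinset c fun g hg => ?_, fun γ => ?_⟩
  · obtain ⟨x, hx⟩ : ∃ x, c g x ≠ 0 := by
      by_contra! hx
      exact hg (ContinuousMap.ext hx)
    exact hfin.mem_toFinset.2 ⟨hθ.toTransfHomeo.symm (x, g), subset_tsupport f hx, rfl⟩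
  · exact congrArg f (hθ.toTransfHomeo.symm_apply_apply γ).symm

variable [CompactSpace X]

/-- The spatial isomorphism between the operators on `ℓ²(𝒢)` and those on `ℓ²(G,ℓ²(X))`, which is
induced by `δ_(x,g,y) ↦ δ_g ⊗ δ_y`. -/
noncomputable def spatialEquiv (hθ : θ.ByHomeomorphisms) :
    (ArrowGroupoid.L2 θ.Arrows →L[ℂ] ArrowGroupoid.L2 θ.Arrows) ≃⋆ₐ[ℂ]
      (hθ.extend.L2 →L[ℂ] hθ.extend.L2) :=
  (doubleBasis hθ.sourceEquiv).repr.symm.conjStarAlgEquiv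

/-- For `γ = (x,g,y)` and `β = (x',h,y')`, the entry of `∑ a_k u_k` vanishes unless `y = y'`, which
is composability of `γ` and `β⁻¹`. Then only `k = gh⁻¹` survives, with value `a_k(θ̃_{g⁻¹}(y)) =
a_k(x) = f(γβ⁻¹)`. -/
theorem isRegularRep_spatialEquiv_symm (hθ : θ.ByHomeomorphisms) {f : C_c(θ.Arrows, ℂ)}
    {a : G →₀ C(X, ℂ)} (h : ∀ γ : θ.Arrows, f γ = a γ.1.2.1 γ.1.1) :
    ArrowGroupoid.IsRegularRep f (hθ.spatialEquiv.symm (hθ.extend.finiteSum a)) := by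
  classical
  intro β γ
  change (doubleBasis hθ.sourceEquiv).repr (hθ.extend.finiteSum a
    ((doubleBasis hθ.sourceEquiv).repr.symm (lp.single 2 β 1))) γ = _
  have hk : ∀ k : G, (k⁻¹ * γ.1.2.1 = β.1.2.1 ∧ γ.1.2.2 = β.1.2.2) ↔
      (k = γ.1.2.1 * β.1.2.1⁻¹ ∧ γ.1.2.2 = β.1.2.2) := fun k =>
    and_congr_left' ⟨fun e => by rw [← e]; group, fun e => by rw [e]; group⟩
  rw [doubleBasis_repr_apply, GroupRightAction.finiteSum_apply]
  simp only [doubleBasis_repr_symm_single_apply]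
  simp only [sourceEquiv, Equiv.coe_fn_mk, hθ.act_inv_target, hk]
  by_cases hc : γ.1.2.2 = β.1.2.2
  · rw [dif_pos (show (γ, ArrowGroupoid.inv β) ∈ ArrowGroupoid.composable from hc), h]
    simp only [hc, and_true, mul_ite, mul_one, mul_zero]
    refine (Finset.sum_ite_eq' a.support (γ.1.2.1 * β.1.2.1⁻¹) fun k => a k γ.1.1).trans ?_
    -- If `gh⁻¹` lies outside the support of `a`, both sides are zero.
    split_ifs with hm
    · rfl
    · rw [Finsupp.notMem_support_iff] at hm
      exact (DFunLike.congr_fun hm γ.1.1).symm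
  · rw [dif_neg (show (γ, ArrowGroupoid.inv β) ∉ ArrowGroupoid.composable from hc)]
    simp [hc]

variable [TopologicalSpace G] [DiscreteTopology G]

/-- The function lives on `Λ⁻¹(X × supp a)`, which is compact since `X` is compact and `supp a`
finite, and closed since `G` is discrete. -/
theorem exists_compactlySupported (hθ : θ.ByHomeomorphisms) (a : G →₀ C(X, ℂ)) :
    ∃ f : C_c(θ.Arrows, ℂ), ∀ γ : θ.Arrows, f γ = a γ.1.2.1 γ.1.1 := by
  have hc : Continuous (fun p : X × G => a p.2 p.1) :=
    continuous_prod_of_discrete_right.2 fun g => (a g).continuous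
  have hK : IsCompact (hθ.toTransfHomeo ⁻¹' (Set.univ ×ˢ (a.support : Set G) : Set (X × G))) :=
    hθ.toTransfHomeo.isCompact_preimage.2 (isCompact_univ.prod a.support.finite_toSet.isCompact)
  have hcl : IsClosed (hθ.toTransfHomeo ⁻¹' (Set.univ ×ˢ (a.support : Set G) : Set (X × G))) :=
    (isClosed_univ.prod (isClosed_discrete _)).preimage hθ.toTransfHomeo.continuous
  refine ⟨⟨⟨fun γ => a γ.1.2.1 γ.1.1, hc.comp hθ.toTransfHomeo.continuous⟩, ?_⟩, fun _ => rfl⟩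
  refine hK.of_isClosed_subset (isClosed_tsupport _) (closure_minimal (fun γ hγ => ?_) hcl)
  refine ⟨trivial, Finsupp.mem_support_iff.2 fun h0 => hγ ?_⟩
  exact DFunLike.congr_fun h0 γ.1.1

theorem image_regularRep (hθ : θ.ByHomeomorphisms) :
    hθ.spatialEquiv '' {T | ∃ f : C_c(θ.Arrows, ℂ), ArrowGroupoid.IsRegularRep f T} =
      Set.range hθ.extend.finiteSum := by
  ext S
  constructor
  · rintro ⟨T, ⟨f, hf⟩, rfl⟩
    obtain ⟨a, ha⟩ := hθ.exists_coeff f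
    refine ⟨a, ?_⟩
    rw [hf.unique (hθ.isRegularRep_spatialEquiv_symm ha), StarAlgEquiv.apply_symm_apply]
  · rintro ⟨a, rfl⟩
    obtain ⟨f, hf⟩ := hθ.exists_compactlySupported a
    exact ⟨_, ⟨f, hθ.isRegularRep_spatialEquiv_symm hf⟩, StarAlgEquiv.apply_symm_apply _ _⟩

/-- The spatial isomorphism as a homeomorphism. -/
noncomputable def spatialHomeo (hθ : θ.ByHomeomorphisms) :
    (ArrowGroupoid.L2 θ.Arrows →L[ℂ] ArrowGroupoid.L2 θ.Arrows) ≃ₜ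
      (hθ.extend.L2 →L[ℂ] hθ.extend.L2) where
  toEquiv := hθ.spatialEquiv.toEquiv
  -- Continuity is automatic: a `*`-isomorphism of C*-algebras is isometric.
  continuous_toFun := (StarAlgEquiv.isometry hθ.spatialEquiv).continuous
  continuous_invFun := (StarAlgEquiv.isometry hθ.spatialEquiv.symm).continuous

/-- The generating sets correspond by `image_regularRep`; forming the generated algebra commutes
with `*`-homomorphisms, and closure with homeomorphisms. -/
theorem map_reducedCstar (hθ : θ.ByHomeomorphisms) :
    NonUnitalStarSubalgebra.map hθ.spatialEquiv (ArrowGroupoid.reducedCstar θ.Arrows) =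
      hθ.extend.crossedProduct := by
  rw [hθ.extend.crossedProduct_eq, ← hθ.image_regularRep, ← NonUnitalStarAlgHom.map_adjoin,
    ArrowGroupoid.reducedCstar]
  exact SetLike.coe_injective (hθ.spatialHomeo.image_closure _)

theorem image_diagonal (hθ : θ.ByHomeomorphisms) :
    hθ.spatialEquiv '' ArrowGroupoid.diagonal θ.Arrows = Set.range hθ.extend.embed := by
  have hcl : IsClosed (Set.range hθ.extend.embed) :=
    hθ.extend.isometry_embed.isClosedEmbedding.isClosed_range
  refine (hθ.spatialHomeo.image_closure _).trans ?_
  rw [← hcl.closure_eq]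
  congr 1
  ext S
  constructor
  · rintro ⟨T, ⟨f, hf, hT⟩, rfl⟩
    obtain ⟨a, ha⟩ := hθ.exists_coeff f
    -- The units are the arrows with `g = 1`, so vanishing off them kills every other coefficient.
    have ha' : a = Finsupp.single 1 (a 1) := by
      ext g x
      by_cases hg : g = 1
      · rw [hg, Finsupp.single_eq_same]
      · have h := ha (hθ.toTransfHomeo.symm (x, g))
        rw [hf _ (fun hu => hg ((hθ.mem_unitSpace_iff _).1 hu))] at h
        rw [Finsupp.single_eq_of_ne hg]
        exact h.symm
    refine ⟨a 1, ?_⟩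
    rw [hT.unique (hθ.isRegularRep_spatialEquiv_symm ha), ← GroupRightAction.finiteSum_single_one,
      ← ha']
    exact (StarAlgEquiv.apply_symm_apply _ _).symm
  · rintro ⟨b, rfl⟩
    obtain ⟨f, hf⟩ := hθ.exists_compactlySupported (Finsupp.single 1 b)
    refine ⟨_, ⟨f, fun γ hγ => ?_, hθ.isRegularRep_spatialEquiv_symm hf⟩, ?_⟩
    · rw [hθ.mem_unitSpace_iff] at hγ
      rw [hf, Finsupp.single_eq_of_ne hγ, ContinuousMap.zero_apply]
    · rw [← GroupRightAction.finiteSum_single_one]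
      exact StarAlgEquiv.apply_symm_apply _ _

end RightSemigroupAction.ByHomeomorphisms

/-! ### The main theorem -/

theorem proposition4p2 {X : Type*} [TopologicalSpace X] [CompactSpace X] [T2Space X]
    [SecondCountableTopology X] [PerfectSpace X]
    {G : Type*} [Group G] [Countable G] [TopologicalSpace G] [DiscreteTopology G]
    (P : Submonoid G) [IsTwoSidedOre P]
    (θ : RightSemigroupAction X P) (hθ : θ.ByHomeomorphisms) :
    ArrowGroupoid.IsEtale θ.Arrows ∧
    ArrowGroupoid.IsEtale hθ.extend.Transf ∧
    ArrowGroupoid.IsTopIso hθ.toTransf ∧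
    ∃ Φ : ArrowGroupoid.reducedCstar θ.Arrows ≃⋆ₐ[ℂ] hθ.extend.crossedProduct,
      -- `Φ` is induced by `Λ`: it maps (the operator of) `f ∈ C_c(𝒢)` to that of `f ∘ Λ⁻¹`,
      -- viewed as an element of the crossed product.
      (∀ f : C_c(θ.Arrows, ℂ), ∃ (T : ArrowGroupoid.reducedCstar θ.Arrows) (a : G →₀ C(X, ℂ)),
        ArrowGroupoid.IsRegularRep f T.1 ∧
        (∀ γ : θ.Arrows, f γ = a (hθ.toTransf γ).2 (hθ.toTransf γ).1) ∧
        (Φ T).1 = hθ.extend.finiteSum a) ∧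
      -- `Φ(C(X)) = C(X)`
      (fun T => (Φ T).1) '' {T | T.1 ∈ ArrowGroupoid.diagonal θ.Arrows} =
        Set.range hθ.extend.embed := by
  have hmem : ∀ T, T ∈ ArrowGroupoid.reducedCstar θ.Arrows ↔
      hθ.spatialEquiv T ∈ hθ.extend.crossedProduct := fun T => by
    rw [← hθ.map_reducedCstar, NonUnitalStarSubalgebra.mem_map]
    exact ⟨fun h => ⟨T, h, rfl⟩, fun ⟨S, hS, e⟩ => hθ.spatialEquiv.injective e ▸ hS⟩
  have hreg : ∀ {f : C_c(θ.Arrows, ℂ)} {T}, ArrowGroupoid.IsRegularRep f T →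
      T ∈ ArrowGroupoid.reducedCstar θ.Arrows := fun {f} {T} h =>
    NonUnitalStarSubalgebra.le_topologicalClosure _
      (NonUnitalStarAlgebra.subset_adjoin ℂ _ ⟨f, h⟩)
  -- With the diagonal inside the reduced algebra, restricting the spatial isomorphism loses none of
  -- its image.
  have hdiag : ArrowGroupoid.diagonal θ.Arrows ⊆ ArrowGroupoid.reducedCstar θ.Arrows :=
    closure_minimal (fun T ⟨_, _, h⟩ => hreg h)
      (NonUnitalStarSubalgebra.isClosed_topologicalClosure _)
  refine ⟨hθ.isTopIso_toTransf.isEtale hθ.extend.isEtale_transf, hθ.extend.isEtale_transf,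
    hθ.isTopIso_toTransf, hθ.spatialEquiv.restrictNonUnital _ _ hmem, fun f => ?_, ?_⟩
  · obtain ⟨a, ha⟩ := hθ.exists_coeff f
    have h := hθ.isRegularRep_spatialEquiv_symm ha
    exact ⟨⟨_, hreg h⟩, a, h, ha, StarAlgEquiv.apply_symm_apply _ _⟩
  · rw [← hθ.image_diagonal]
    exact StarAlgEquiv.restrictNonUnital_image _ _ _ hmem hdiag
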